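/- Let $p$ be a prime and let $K$ be a global field of characteristic $p$, i.e. a finite extension of the rational function field $\mathbb{F}_p(t)$. Let $\Gamma$ be a finitely generated group that admits a faithful (i.e. injective) homomorphism into $\mathrm{PGL}_2(K)$. Then there are finitely many trees $T_1,\dots,T_n$ of finite (indeed bounded) valence, i.e. for each $i$ there is an integer $d_i$ such that every vertex of $T_i$ has at most $d_i$ neighbours, and a discrete and faithful representation of $\Gamma$ into $\mathrm{Aut}(Y)$, where $Y = T_1\times\cdots\times T_n$. Here $\mathrm{Aut}(Y)$ is the group of automorphisms of the product cell complex $Y$, that is, the permutations of its vertex set which together with their inverses carry cells to cells (a cell of $Y$ being a product of vertices and edges of the factors), with the topology of pointwise convergence on the discrete vertex set (equivalently, the compact-open topology), and a representation $\rho:\Gamma\to\mathrm{Aut}(Y)$ is discrete if its image $\rho(\Gamma)$ is a discrete subgroup of $\mathrm{Aut}(Y)$. -/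

import Mathlib

open scoped MatrixGroups

namespace TreeProduct

/-- A (closed) cell of the one-dimensional complex given by a graph, recorded by its set of vertices:
either a single vertex or the pair of endpoints of an edge. -/
def IsCell {W : Type*} (G : SimpleGraph W) (s : Set W) : Prop :=
  (∃ v, s = {v}) ∨ ∃ v w, G.Adj v w ∧ s = {v, w}

/-- A (closed) cell of the product complex `∏ i, T i`, recorded by its set of vertices:
a product of cells of the factors. -/
def IsProdCell {ι : Type*} {V : ι → Type*} (T : ∀ i, SimpleGraph (V i))
    (c : Set (∀ i, V i)) : Prop :=
  ∃ s : ∀ i, Set (V i), (∀ i, IsCell (T i) (s i)) ∧ c = Set.univ.pi s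

/-- The group `Aut(Y)` of automorphisms of the cell complex `Y = ∏ i, T i`: the permutations of the
vertices that carry cells to cells, in both directions. Such an automorphism may permute the factors
of the product and may invert edges. -/
def Aut {ι : Type*} {V : ι → Type*} (T : ∀ i, SimpleGraph (V i)) :
    Subgroup (Equiv.Perm (∀ i, V i)) where
  carrier := {g | ∀ c : Set (∀ i, V i), IsProdCell T (g '' c) ↔ IsProdCell T c}
  one_mem' := fun c => by simp
  mul_mem' := by
    intro g h hg hh c
    rw [← hh c, ← hg (h '' c), ← Set.image_comp, Equiv.Perm.coe_mul]
  inv_mem' := by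
    intro g hg c
    rw [← hg, ← Set.image_comp, ← Equiv.Perm.coe_mul, mul_inv_cancel, Equiv.Perm.coe_one,
      Set.image_id]

/-- The topology of `Aut(Y)`: pointwise convergence on the (discrete) set of vertices of `Y`. For a
product of finitely many locally finite trees it is the compact-open topology. -/
instance instTopologicalSpaceAut {ι : Type*} {V : ι → Type*} (T : ∀ i, SimpleGraph (V i)) :
    TopologicalSpace (Aut T) :=
  TopologicalSpace.induced
    (fun (g : Aut T) (v : ∀ i, V i) => (g : Equiv.Perm (∀ i, V i)) v)
    (@Pi.topologicalSpace (∀ i, V i) (fun _ => ∀ i, V i) (fun _ => ⊥))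

/-- A tree of bounded valence: there is a finite bound on the number of edges at a vertex. In
particular every vertex has finite valence. -/
def IsBoundedValenceTree {W : Type*} (G : SimpleGraph W) : Prop :=
  G.IsTree ∧ ∃ d : ℕ, ∀ v : W, (G.neighborSet v).encard ≤ d

end TreeProduct

/-! The group acts diagonally on the Bruhat–Tits trees of a function field at finitely many places,
and discreteness comes from the finiteness of the set of functions without poles.

The products `g i j * g⁻¹ k l` are the coefficients of conjugation by `g`, so they make sense on
`PGL₂` and replace the entries of a matrix. For lifts of the generators they form a finite set.
`exists_change_of_variable` chooses a variable `X` for which this set is integral over `k[X⁻¹]`,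
where `k = 𝔽_p`, and `exists_separable_embedding` moves the field, by a power of Frobenius, into a
separable extension `L` of `k(X)`. Integrality of all conjugation coefficients defines a subgroup,
so it passes from the generators to all of `Γ`.

In `exists_action_on_trees`, `GL₂(L)` acts on the product of the trees at the places over `X = 0`.
If an element of `Γ` fixes the base vertex, its coefficients are integral at these places too. They
then have no poles, and `finite_setOf_integral_everywhere` leaves finitely many values. By
`inv_mul_mem_center` they determine the element modulo scalars. Hence the vertex stabilizer is
finite, and `discreteTopology_of_finite_stabilizer` applies. Faithfulness is already visible on a
single tree (`mem_center_of_smul_eq`). -/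

namespace TreeProduct

/-! ### Trees described by parent maps -/

/-- A graph with a parent map without periodic points, in which the edges join the vertices with
their parents and any two vertices have a common ancestor, is a tree. -/
theorem isTree_of_parent {W : Type*} [Nonempty W] (G : SimpleGraph W) (f : W → W)
    (hadj : ∀ v w, G.Adj v w ↔ w = f v ∨ v = f w)
    (hf : ∀ (k : ℕ) v, f^[k + 1] v ≠ v)
    (hanc : ∀ v w, ∃ k l : ℕ, f^[k] v = f^[l] w) : G.IsTree := by
  have hreach : ∀ (k : ℕ) v, G.Reachable v (f^[k] v) := by
    intro k
    induction k with
    | zero => exact fun v => .refl _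
    | succ k ih =>
      intro v
      rw [Function.iterate_succ_apply']
      exact (ih v).trans (SimpleGraph.Adj.reachable ((hadj _ _).2 (Or.inl rfl)))
  refine ⟨⟨fun v w => ?_⟩, ?_⟩
  · obtain ⟨k, l, h⟩ := hanc v w
    exact (hreach k v).trans (h ▸ (hreach l w).symm)
  -- Every edge is a bridge: once it is deleted, the descendants of `v` are closed under adjacency,
  -- and `f v` is not among them because `f` has no periodic points.
  · have key : ∀ v, ¬ (G.deleteEdges {s(v, f v)}).Reachable v (f v) := by
      intro v hr
      have hclosed : ∀ a b, (G.deleteEdges {s(v, f v)}).Adj a b →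
          (∃ k : ℕ, f^[k] a = v) → ∃ k : ℕ, f^[k] b = v := by
        rintro a b hab ⟨k, hk⟩
        rw [SimpleGraph.deleteEdges_adj] at hab
        rcases (hadj _ _).1 hab.1 with rfl | rfl
        · cases k with
          | zero =>
            obtain rfl : a = v := hk
            exact absurd rfl hab.2
          | succ k => exact ⟨k, hk⟩
        · exact ⟨k + 1, hk⟩
      obtain ⟨p⟩ := hr
      have hwalk : ∀ {a b} (q : (G.deleteEdges {s(v, f v)}).Walk a b),
          (∃ k : ℕ, f^[k] a = v) → ∃ k : ℕ, f^[k] b = v := by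
        intro a b q
        induction q with
        | nil => exact id
        | cons h _ ih => exact fun ha => ih (hclosed _ _ h ha)
      obtain ⟨k, hk⟩ := hwalk p ⟨0, rfl⟩
      exact hf k v hk
    refine SimpleGraph.isAcyclic_iff_forall_adj_isBridge.2 fun v w h => ?_
    rcases (hadj _ _).1 h with rfl | rfl
    · exact key v
    · rw [Sym2.eq_swap]
      exact key w

/-! ### Diagonal actions and discreteness in `Aut(Y)` -/

theorem IsCell.image {W : Type*} {G : SimpleGraph W} {f : W → W}
    (hf : ∀ v w, G.Adj v w → G.Adj (f v) (f w)) {s : Set W} (hs : IsCell G s) :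
    IsCell G (f '' s) := by
  rcases hs with ⟨v, rfl⟩ | ⟨v, w, h, rfl⟩
  · exact Or.inl ⟨f v, Set.image_singleton⟩
  · exact Or.inr ⟨f v, f w, hf _ _ h, Set.image_pair _ _ _⟩

section Action

variable {G : Type*} [Group G] {ι : Type*} {V : ι → Type*} (T : ∀ i, SimpleGraph (V i))
  [∀ i, MulAction G (V i)] (hT : ∀ i (g : G) v w, (T i).Adj v w → (T i).Adj (g • v) (g • w))

include hT in
theorem isProdCell_smul (g : G) {c : Set (∀ i, V i)} (hc : IsProdCell T c) :
    IsProdCell T ((fun x => g • x) '' c) := by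
  obtain ⟨s, hs, rfl⟩ := hc
  exact ⟨fun i => (fun x => g • x) '' s i, fun i => (hs i).image (hT i g),
    Set.piMap_image_univ_pi (fun i (x : V i) => g • x) s⟩

/-- The diagonal action on a product of graphs of a group that acts on each of them by graph
automorphisms. -/
def diagonalAut : G →* Aut T :=
  (MulAction.toPermHom G (∀ i, V i)).codRestrict (Aut T) fun g c => by
    refine ⟨fun h => ?_, isProdCell_smul T hT g⟩
    have := isProdCell_smul T hT g⁻¹ h
    rw [← Set.image_comp] at this
    convert this
    ext x
    simp

@[simp] theorem diagonalAut_apply (g : G) (x : ∀ i, V i) :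
    (diagonalAut T hT g : Equiv.Perm (∀ i, V i)) x = g • x := rfl

end Action

theorem isOpen_setOf_apply_eq {ι : Type*} {V : ι → Type*} (T : ∀ i, SimpleGraph (V i))
    (v w : ∀ i, V i) : IsOpen {g : Aut T | (g : Equiv.Perm (∀ i, V i)) v = w} := by
  have h : @IsOpen _ (@Pi.topologicalSpace (∀ i, V i) (fun _ => ∀ i, V i) (fun _ => ⊥))
      ((fun F : (∀ i, V i) → ∀ i, V i => F v) ⁻¹' {w}) :=
    @IsOpen.preimage _ _ (_) ⊥ _
      (@continuous_apply (∀ i, V i) (fun _ => ∀ i, V i) (fun _ => ⊥) v) {w} trivial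
  exact ⟨_, h, rfl⟩

/-- A subgroup of `Aut T` is discrete if the stabilizer of some vertex in it is finite. -/
theorem discreteTopology_of_finite_stabilizer {ι : Type*} {V : ι → Type*}
    {T : ∀ i, SimpleGraph (V i)} (H : Subgroup (Aut T)) (x : ∀ i, V i)
    (hfin : {h : H | ((h : Aut T) : Equiv.Perm (∀ i, V i)) x = x}.Finite) :
    DiscreteTopology H := by
  refine discreteTopology_iff_isOpen_singleton.2 fun g => ?_
  have hopen : ∀ v w : ∀ i, V i,
      IsOpen {h : H | ((h : Aut T) : Equiv.Perm (∀ i, V i)) v = w} := fun v w =>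
    (isOpen_setOf_apply_eq T v w).preimage continuous_subtype_val
  set gx := ((g : Aut T) : Equiv.Perm (∀ i, V i)) x with hgx
  set U := {h : H | ((h : Aut T) : Equiv.Perm (∀ i, V i)) x = gx} with hU
  -- `U` is a left coset of the stabilizer of `x`.
  have hUfin : U.Finite := by
    refine (hfin.image (fun h => g * h)).subset fun h hh => ⟨g⁻¹ * h, ?_, by simp⟩
    have hh : ((h : Aut T) : Equiv.Perm (∀ i, V i)) x = gx := hh
    simp [hh, hgx]
  have hsep : ∀ h : H, h ≠ g → ∃ v, ((h : Aut T) : Equiv.Perm (∀ i, V i)) v ≠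
      ((g : Aut T) : Equiv.Perm (∀ i, V i)) v := by
    intro h hne
    by_contra! hcon
    exact hne (Subtype.ext (Subtype.ext (Equiv.ext hcon)))
  have : Nonempty (∀ i, V i) := ⟨x⟩
  choose! v hv using hsep
  -- Within the finite open set `U`, one separating vertex for each other element isolates `g`.
  have heq : ({g} : Set H) = U ∩ ⋂ h ∈ U \ {g},
      {k : H | ((k : Aut T) : Equiv.Perm (∀ i, V i)) (v h) =
        ((g : Aut T) : Equiv.Perm (∀ i, V i)) (v h)} := by
    ext k
    simp only [Set.mem_singleton_iff, Set.mem_inter_iff, Set.mem_iInter, Set.mem_ofPred_eq]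
    refine ⟨?_, fun hk => ?_⟩
    · rintro rfl
      exact ⟨rfl, fun _ _ => rfl⟩
    · by_contra hne
      exact hv k hne (hk.2 k ⟨hk.1, hne⟩)
  rw [heq]
  exact (hopen _ _).inter ((hUfin.subset Set.sdiff_subset).isOpen_biInter fun h _ => hopen _ _)

end TreeProduct

namespace TreeProduct

open WithZero
open scoped Matrix

/-! ### Coefficients of the adjoint representation -/

section EntryProducts

variable {L : Type*} [Field L]

/-- Multiplicativity of conjugation, in coordinates. It makes integrality of the coefficients stable
under products and bounds on them submultiplicative. -/
theorem entry_mul_inv_entry_mul (g h : GL (Fin 2) L) (i j k l : Fin 2) :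
    (g * h) i j * (g * h)⁻¹ k l =
      ∑ a, ∑ b, (g i a * g⁻¹ b l) * (h a j * h⁻¹ k b) := by
  rw [mul_inv_rev]
  simp only [Units.val_mul, Matrix.mul_apply, Finset.sum_mul_sum]
  exact Finset.sum_congr rfl fun a _ => Finset.sum_congr rfl fun b _ => by ring

/-- The subgroup of those `g` for which conjugation by `g` has coefficients in `R`. -/
def adjointIntegral (R : Subring L) : Subgroup (GL (Fin 2) L) where
  carrier := {g | ∀ i j k l, g i j * g⁻¹ k l ∈ R}
  one_mem' := by
    intro i j k l
    rw [inv_one, Units.val_one, Matrix.one_apply, Matrix.one_apply]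
    split_ifs <;> simp [R.one_mem, R.zero_mem]
  mul_mem' := by
    intro g h hg hh i j k l
    rw [entry_mul_inv_entry_mul]
    exact R.sum_mem fun a _ => R.sum_mem fun b _ => R.mul_mem (hg _ _ _ _) (hh _ _ _ _)
  inv_mem' := by
    intro g hg i j k l
    rw [inv_inv, mul_comm]
    exact hg _ _ _ _

theorem center_le_adjointIntegral (R : Subring L) :
    Subgroup.center (GL (Fin 2) L) ≤ adjointIntegral R := by
  intro g hg i j k l
  rw [Matrix.GeneralLinearGroup.center_eq_range_scalar] at hg
  obtain ⟨u, rfl⟩ := hg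
  rw [← map_inv]
  simp only [Matrix.GeneralLinearGroup.coe_scalar, Matrix.scalar_apply, Matrix.diagonal_apply]
  split_ifs <;> simp [R.one_mem, R.zero_mem]

theorem mem_center_iff_entries {g : GL (Fin 2) L} :
    g ∈ Subgroup.center (GL (Fin 2) L) ↔ g 0 1 = 0 ∧ g 1 0 = 0 ∧ g 0 0 = g 1 1 := by
  rw [Matrix.GeneralLinearGroup.mem_center_iff_val_mem_range_scalar]
  constructor
  · rintro ⟨c, hc⟩
    rw [← hc]
    simp
  · rintro ⟨h1, h2, h3⟩
    refine ⟨g 0 0, ?_⟩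
    ext i j
    fin_cases i <;> fin_cases j <;> simp [h1, h2, h3]

/-- The products of the entries of a matrix and of its inverse determine the matrix up to a
scalar. -/
theorem inv_mul_mem_center {g h : GL (Fin 2) L}
    (H : ∀ i j k l, g i j * g⁻¹ k l = h i j * h⁻¹ k l) :
    g⁻¹ * h ∈ Subgroup.center (GL (Fin 2) L) := by
  have hgh : ∀ x : Matrix (Fin 2) (Fin 2) L,
      g.1 * x * (g⁻¹).1 = h.1 * x * (h⁻¹).1 := by
    intro x
    ext i l
    simp only [Matrix.mul_apply, Finset.sum_mul]
    refine Finset.sum_congr rfl fun a _ => Finset.sum_congr rfl fun b _ => ?_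
    linear_combination x b a * H i b a l
  rw [Subgroup.mem_center_iff]
  intro x
  have hx : g * x * g⁻¹ = h * x * h⁻¹ := Units.ext (hgh x.1)
  calc x * (g⁻¹ * h) = g⁻¹ * (g * x * g⁻¹) * h := by group
    _ = g⁻¹ * h * x := by rw [hx]; group

end EntryProducts

/-! ### The Bruhat–Tits tree -/

section Tree

variable {L : Type*} [Field L] (v : Valuation L ℤᵐ⁰)

/-- All products of an entry of `g` and an entry of `g⁻¹` have valuation at most `r`. -/
def EntryBound (g : GL (Fin 2) L) (r : ℤᵐ⁰) : Prop :=
  ∀ i j k l, v (g i j * g⁻¹ k l) ≤ r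

variable {v}

theorem EntryBound.mul {g h : GL (Fin 2) L} {r s : ℤᵐ⁰} (hg : EntryBound v g r)
    (hh : EntryBound v h s) : EntryBound v (g * h) (r * s) := by
  intro i j k l
  rw [entry_mul_inv_entry_mul]
  refine v.map_sum_le fun a _ => v.map_sum_le fun b _ => ?_
  rw [map_mul]
  exact mul_le_mul' (hg _ _ _ _) (hh _ _ _ _)

theorem EntryBound.inv {g : GL (Fin 2) L} {r : ℤᵐ⁰} (hg : EntryBound v g r) :
    EntryBound v g⁻¹ r := by
  intro i j k l
  rw [inv_inv, mul_comm]
  exact hg _ _ _ _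

variable (v)

/-- The vertices of the Bruhat-Tits tree. -/
abbrev BTVertex : Type _ := GL (Fin 2) L ⧸ adjointIntegral v.integer

theorem mem_adjointIntegral_integer {g : GL (Fin 2) L} :
    g ∈ adjointIntegral v.integer ↔ EntryBound v g 1 := Iff.rfl

/-- The Bruhat-Tits tree of `PGL₂` of a discretely valued field. -/
def btGraph : SimpleGraph (BTVertex v) where
  Adj x y := x ≠ y ∧ ∃ g h : GL (Fin 2) L,
    x = QuotientGroup.mk g ∧ y = QuotientGroup.mk h ∧ EntryBound v (g⁻¹ * h) (exp 1)
  symm := ⟨by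
    rintro x y ⟨hne, g, h, hx, hy, hb⟩
    refine ⟨hne.symm, h, g, hy, hx, ?_⟩
    simpa using hb.inv⟩
  loopless := ⟨fun x h => h.1 rfl⟩

/-- Changing representatives multiplies `g⁻¹ * h` on both sides by elements of bound `1`, which
leaves every bound unchanged. -/
theorem btGraph_adj_mk (g h : GL (Fin 2) L) :
    (btGraph v).Adj (QuotientGroup.mk g) (QuotientGroup.mk h) ↔
      ¬ EntryBound v (g⁻¹ * h) 1 ∧ EntryBound v (g⁻¹ * h) (exp 1) := by
  rw [← mem_adjointIntegral_integer, ← QuotientGroup.eq]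
  refine and_congr_right fun _ => ⟨?_, fun hb => ⟨g, h, rfl, rfl, hb⟩⟩
  rintro ⟨g', h', hg, hh, hb⟩
  have hg := QuotientGroup.eq.1 hg
  have hh := QuotientGroup.eq.1 hh.symm
  rw [mem_adjointIntegral_integer] at hg hh
  simpa [mul_assoc] using (hg.mul hb).mul hh

theorem btGraph_adj_smul (k : GL (Fin 2) L) (x y : BTVertex v) (h : (btGraph v).Adj x y) :
    (btGraph v).Adj (k • x) (k • y) := by
  obtain ⟨g, rfl⟩ := QuotientGroup.mk_surjective x
  obtain ⟨g', rfl⟩ := QuotientGroup.mk_surjective y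
  rw [MulAction.Quotient.smul_mk, MulAction.Quotient.smul_mk]
  rw [btGraph_adj_mk] at h ⊢
  simpa [mul_assoc] using h

theorem center_smul_btVertex {z : GL (Fin 2) L} (hz : z ∈ Subgroup.center (GL (Fin 2) L))
    (x : BTVertex v) : z • x = x := by
  obtain ⟨g, rfl⟩ := QuotientGroup.mk_surjective x
  rw [MulAction.Quotient.smul_mk, smul_eq_mul, ← Subgroup.mem_center_iff.1 hz g]
  exact QuotientGroup.mk_mul_of_mem _ (center_le_adjointIntegral _ hz)

/-- The affine transformation `x ↦ d * x + a` as an element of `GL₂`. -/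
def affine (d : Lˣ) (a : L) : GL (Fin 2) L where
  val := !![d, a; 0, 1]
  inv := !![((d⁻¹ : Lˣ) : L), -((d⁻¹ : Lˣ) : L) * a; 0, 1]
  val_inv := by ext i j; fin_cases i <;> fin_cases j <;> simp [Matrix.mul_apply]
  inv_val := by ext i j; fin_cases i <;> fin_cases j <;> simp [Matrix.mul_apply]

theorem coe_affine (d : Lˣ) (a : L) :
    (affine d a : Matrix (Fin 2) (Fin 2) L) = !![(d : L), a; 0, 1] := rfl

theorem coe_affine_inv (d : Lˣ) (a : L) :
    ((affine d a)⁻¹ : GL (Fin 2) L) =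
      !![((d⁻¹ : Lˣ) : L), -((d⁻¹ : Lˣ) : L) * a; 0, 1] := rfl

theorem affine_inv_mul (d e : Lˣ) (a c : L) :
    (affine d a)⁻¹ * affine e c = affine (d⁻¹ * e) (((d⁻¹ : Lˣ) : L) * (c - a)) := by
  apply Units.ext
  rw [Units.val_mul, coe_affine_inv, coe_affine, coe_affine]
  ext i j
  fin_cases i <;> fin_cases j <;> simp [Matrix.mul_apply]
  ring

theorem exists_valuation_eq_exp {x : L} (hx : x ≠ 0) : ∃ m : ℤ, v x = exp m :=
  ⟨log (v x), (exp_log ((v.ne_zero_iff).2 hx)).symm⟩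

theorem entryBound_affine_iff (d : Lˣ) (x : L) (r : ℤᵐ⁰) :
    EntryBound v (affine d x) r ↔ 1 ≤ r ∧ v d ≤ r ∧ (v d)⁻¹ ≤ r ∧ v x ≤ r ∧
      (v d)⁻¹ * v x ≤ r ∧ v x * ((v d)⁻¹ * v x) ≤ r := by
  simp only [EntryBound, coe_affine_inv, coe_affine, Fin.forall_fin_two]
  simp
  grind

theorem entryBound_affine_one_iff (d : Lˣ) (x : L) :
    EntryBound v (affine d x) 1 ↔ v d = 1 ∧ v x ≤ 1 := by
  rw [entryBound_affine_iff]
  obtain ⟨m, hm⟩ := exists_valuation_eq_exp v d.ne_zero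
  rw [hm, ← exp_neg, ← exp_zero]
  constructor
  · rintro ⟨-, h1, h2, h3, -⟩
    rw [exp_le_exp] at h1 h2
    exact ⟨by rw [exp_inj]; omega, h3⟩
  · rintro ⟨h1, h2⟩
    rw [exp_inj] at h1
    subst h1
    simp only [neg_zero, exp_zero] at h2 ⊢
    simpa using h2

/-- The two cases are the two directions along an edge: a ball shrinks to a child or grows to its
parent. -/
theorem entryBound_affine_exp_one_iff (d : Lˣ) (x : L) :
    (¬ EntryBound v (affine d x) 1 ∧ EntryBound v (affine d x) (exp 1)) ↔
      (v d = exp (-1) ∧ v x ≤ 1) ∨ (v d = exp 1 ∧ v x ≤ exp 1) := by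
  rw [entryBound_affine_one_iff, entryBound_affine_iff]
  obtain ⟨m, hm⟩ := exists_valuation_eq_exp v d.ne_zero
  rw [hm, ← exp_neg, ← exp_zero]
  rcases eq_or_ne x 0 with rfl | hx
  · simp only [map_zero, mul_zero, zero_le, exp_le_exp, exp_inj]
    constructor <;> intro h <;> simp at h ⊢ <;> omega
  · obtain ⟨n, hn⟩ := exists_valuation_eq_exp v hx
    rw [hn]
    simp only [← exp_add, exp_le_exp, exp_inj]
    omega

variable {v}

/-- The vertex of `affine d a` is in effect the closed ball with centre `a` and radius `v d`. -/
theorem mk_affine_eq_iff (d e : Lˣ) (a c : L) :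
    (QuotientGroup.mk (affine d a) : BTVertex v) = QuotientGroup.mk (affine e c) ↔
      v d = v e ∧ v (c - a) ≤ v d := by
  have hd : 0 < v d := zero_lt_iff.2 ((v.ne_zero_iff).2 d.ne_zero)
  rw [QuotientGroup.eq, mem_adjointIntegral_integer, affine_inv_mul, entryBound_affine_one_iff]
  simp only [Units.val_mul, Units.val_inv_eq_inv_val, map_mul, map_inv₀]
  rw [inv_mul_eq_one₀ hd.ne', inv_mul_le_iff₀ hd, mul_one]

theorem btGraph_adj_affine (d e : Lˣ) (a c : L) :
    (btGraph v).Adj (QuotientGroup.mk (affine d a)) (QuotientGroup.mk (affine e c)) ↔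
      (v e = v d * exp (-1) ∧ v (c - a) ≤ v d) ∨ (v d = v e * exp (-1) ∧ v (c - a) ≤ v e) := by
  have hd : 0 < v d := zero_lt_iff.2 ((v.ne_zero_iff).2 d.ne_zero)
  rw [btGraph_adj_mk, affine_inv_mul, entryBound_affine_exp_one_iff]
  simp only [Units.val_mul, Units.val_inv_eq_inv_val, map_mul, map_inv₀]
  rw [inv_mul_le_iff₀ hd, mul_one, inv_mul_le_iff₀ hd, inv_mul_eq_iff_eq_mul₀ hd.ne',
    inv_mul_eq_iff_eq_mul₀ hd.ne']
  refine or_congr Iff.rfl ⟨?_, ?_⟩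
  · rintro ⟨h1, h2⟩
    rw [h1]
    refine ⟨?_, h2⟩
    rw [mul_assoc, ← exp_add]
    simp
  · rintro ⟨h1, h2⟩
    have h3 : v e = v d * exp 1 := by
      rw [h1, mul_assoc, ← exp_add]
      simp
    exact ⟨h3, h3 ▸ h2⟩

/-- Iwasawa decomposition: `g` is affine times a scalar times a lower unipotent matrix, whose corner
`g 1 0 / g 1 1` is integral by hypothesis. -/
theorem exists_eq_mk_affine_of_le {g : GL (Fin 2) L} (h : v (g 1 0) ≤ v (g 1 1)) :
    ∃ d a, (QuotientGroup.mk g : BTVertex v) = QuotientGroup.mk (affine d a) := by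
  have hdet : g 0 0 * g 1 1 - g 0 1 * g 1 0 ≠ 0 := by
    rw [← Matrix.det_fin_two]
    exact g.det.ne_zero
  have h11 : g 1 1 ≠ 0 := by
    intro h0
    rw [h0, map_zero, le_zero_iff, v.zero_iff] at h
    simp [h, h0] at hdet
  have h11' : v (g 1 1) ≠ 0 := (v.ne_zero_iff).2 h11
  let m : GL (Fin 2) L :=
    ⟨!![g 1 1, 0; g 1 0, g 1 1], !![(g 1 1)⁻¹, 0; -(g 1 0) * (g 1 1)⁻¹ ^ 2, (g 1 1)⁻¹],
      by ext i j; fin_cases i <;> fin_cases j <;>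
        simp [Matrix.mul_apply, h11] <;> (field_simp; ring),
      by ext i j; fin_cases i <;> fin_cases j <;>
        simp [Matrix.mul_apply, h11] <;> (field_simp; ring)⟩
  have hm : m ∈ adjointIntegral v.integer := by
    rw [mem_adjointIntegral_integer]
    have h1 : v (g 1 0) * (v (g 1 1))⁻¹ ≤ 1 := mul_inv_le_one_of_le₀ h zero_le
    have h2 : v (g 1 0) * (v (g 1 0) * (v (g 1 1) ^ 2)⁻¹) ≤ 1 := by
      rw [pow_two, mul_inv]
      calc _ = (v (g 1 0) * (v (g 1 1))⁻¹) * (v (g 1 0) * (v (g 1 1))⁻¹) := by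
            simp only [mul_left_comm, mul_comm]
        _ ≤ 1 := mul_le_one' h1 h1
    have h3 : v (g 1 1) * (v (g 1 0) * (v (g 1 1) ^ 2)⁻¹) ≤ 1 := by
      rw [pow_two, mul_inv, ← mul_assoc, ← mul_assoc, mul_assoc (v (g 1 1)), mul_comm (v (g 1 1)),
        mul_assoc _ (v (g 1 1)), mul_inv_cancel₀ h11', mul_one]
      exact h1
    simp only [EntryBound, Fin.forall_fin_two]
    simp [m, h11', h1, h2, h3]
  refine ⟨Units.mk0 ((g 0 0 * g 1 1 - g 0 1 * g 1 0) * (g 1 1)⁻¹ ^ 2)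
    (mul_ne_zero hdet (pow_ne_zero _ (inv_ne_zero h11))), g 0 1 * (g 1 1)⁻¹, ?_⟩
  refine (congrArg _ (Units.ext ?_)).trans (QuotientGroup.mk_mul_of_mem _ hm)
  rw [Units.val_mul, coe_affine]
  ext i j
  fin_cases i <;> fin_cases j <;> simp [Matrix.mul_apply, m] <;> field_simp
  ring

variable (v)

/-- Every vertex of the Bruhat-Tits tree is represented by an affine transformation. -/
theorem exists_eq_mk_affine (x : BTVertex v) :
    ∃ d a, x = QuotientGroup.mk (affine d a) := by
  obtain ⟨g, rfl⟩ := QuotientGroup.mk_surjective x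
  rcases le_total (v (g 1 0)) (v (g 1 1)) with h | h
  · exact exists_eq_mk_affine_of_le h
  -- Swapping the columns reduces to the other case.
  · let w : GL (Fin 2) L := ⟨!![0, 1; 1, 0], !![0, 1; 1, 0],
      by ext i j; fin_cases i <;> fin_cases j <;> simp [Matrix.mul_apply],
      by ext i j; fin_cases i <;> fin_cases j <;> simp [Matrix.mul_apply]⟩
    have hw : w ∈ adjointIntegral v.integer := by
      rw [mem_adjointIntegral_integer]
      simp only [EntryBound, Fin.forall_fin_two]
      simp [w]
    rw [← QuotientGroup.mk_mul_of_mem g hw]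
    refine exists_eq_mk_affine_of_le ?_
    simpa [w, Matrix.mul_apply] using h

variable {v}

theorem valuation_mul_zpow {π : L} (hπ : v π = exp (-1)) (x : L) (k : ℤ) :
    v (x * π ^ k) = v x * exp (-k) := by
  rw [map_mul, map_zpow₀, hπ, ← exp_zsmul]
  simp

variable (v)

/-- The Bruhat-Tits graph of a discretely valued field with uniformizer `π` and finite residue field
is a tree of bounded valence. -/
theorem isBoundedValenceTree_btGraph (π : Lˣ) (hπ : v π = exp (-1)) (R : Set L) (hR : R.Finite)
    (hres : ∀ x, v x ≤ 1 → ∃ r ∈ R, v (x - r) ≤ exp (-1)) :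
    IsBoundedValenceTree (btGraph v) := by
  have hpow : ∀ (d : Lˣ) (k : ℤ), v ((d * π ^ k : Lˣ) : L) = v d * exp (-k) := fun d k => by
    rw [Units.val_mul, Units.val_zpow_eq_zpow_val, valuation_mul_zpow hπ]
  choose D A hDA using exists_eq_mk_affine v
  -- The parent of a ball has the same centre and a radius larger by the factor `exp 1`.
  let f : BTVertex v → BTVertex v := fun x =>
    QuotientGroup.mk (affine (D x * π ^ (-1 : ℤ)) (A x))
  have hf : ∀ d a, f (QuotientGroup.mk (affine d a)) =
      QuotientGroup.mk (affine (d * π ^ (-1 : ℤ)) a) := by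
    intro d a
    obtain ⟨h1, h2⟩ := (mk_affine_eq_iff _ _ _ _).1 (hDA (QuotientGroup.mk (affine d a)))
    refine (mk_affine_eq_iff _ _ _ _).2 ⟨?_, ?_⟩
    · rw [hpow, hpow, h1]
    · rw [hpow, ← h1, Valuation.map_sub_swap]
      exact h2.trans (le_mul_of_one_le_right zero_le (by rw [← exp_zero, exp_le_exp]; omega))
  have hfk : ∀ (k : ℕ) d a, f^[k] (QuotientGroup.mk (affine d a)) =
      QuotientGroup.mk (affine (d * π ^ (-k : ℤ)) a) := by
    intro k
    induction k with
    | zero => simp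
    | succ k ih =>
      intro d a
      rw [Function.iterate_succ_apply, hf, ih, mul_assoc, ← zpow_add]
      congr 4
      push_cast
      ring
  have hadj : ∀ x y, (btGraph v).Adj x y ↔ y = f x ∨ x = f y := by
    intro x y
    obtain ⟨d, a, rfl⟩ := exists_eq_mk_affine v x
    obtain ⟨e, c, rfl⟩ := exists_eq_mk_affine v y
    rw [btGraph_adj_affine, hf, hf, mk_affine_eq_iff, mk_affine_eq_iff, hpow, hpow, neg_neg,
      or_comm]
    have key : ∀ s t : Lˣ, v s = v t * exp (-1) ↔ v t = v s * exp 1 := by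
      intro s t
      constructor <;> intro h <;> rw [h, mul_assoc, ← exp_add] <;> simp
    rw [key, key, Valuation.map_sub_swap v c a, Valuation.map_sub_swap v a c]
  refine ⟨isTree_of_parent _ f hadj ?_ ?_, hR.toFinset.card + 1, fun x => ?_⟩
  · intro k x hk
    obtain ⟨d, a, rfl⟩ := exists_eq_mk_affine v x
    rw [hfk, mk_affine_eq_iff, hpow] at hk
    obtain ⟨m, hm⟩ := exists_valuation_eq_exp v d.ne_zero
    rw [hm, ← exp_add, exp_inj] at hk
    have := hk.1
    push_cast at this
    omega
  · intro x y
    obtain ⟨d, a, rfl⟩ := exists_eq_mk_affine v x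
    obtain ⟨e, c, rfl⟩ := exists_eq_mk_affine v y
    obtain ⟨m, hm⟩ := exists_valuation_eq_exp v d.ne_zero
    obtain ⟨n, hn⟩ := exists_valuation_eq_exp v e.ne_zero
    -- A common ancestor is a ball of radius `exp N` large enough to contain both balls.
    obtain ⟨N, hmN, hnN, hN⟩ : ∃ N : ℤ, m ≤ N ∧ n ≤ N ∧ v (c - a) ≤ exp N := by
      rcases eq_or_ne (c - a) 0 with h0 | h0
      · exact ⟨max m n, le_max_left _ _, le_max_right _ _, by simp [h0]⟩
      · obtain ⟨l, hl⟩ := exists_valuation_eq_exp v h0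
        refine ⟨max (max m n) l, by omega, by omega, ?_⟩
        rw [hl, exp_le_exp]
        omega
    refine ⟨(N - m).toNat, (N - n).toNat, ?_⟩
    rw [hfk, hfk, mk_affine_eq_iff, hpow, hpow, hm, hn, ← exp_add, ← exp_add]
    have h1 : m + - -(((N - m).toNat : ℕ) : ℤ) = N := by omega
    have h2 : n + - -(((N - n).toNat : ℕ) : ℤ) = N := by omega
    rw [h1, h2]
    exact ⟨rfl, hN⟩
  · obtain ⟨d, a, rfl⟩ := exists_eq_mk_affine v x
    -- Besides the parent, the neighbours are the maximal proper subballs, each obtained from some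
    -- residue representative in `R`.
    have hsub : (btGraph v).neighborSet (QuotientGroup.mk (affine d a)) ⊆
        insert (f (QuotientGroup.mk (affine d a)))
          ((fun r : L => QuotientGroup.mk (affine (d * π) (a + d * r))) '' R) := by
      intro y hy
      obtain ⟨e, c, rfl⟩ := exists_eq_mk_affine v y
      rw [SimpleGraph.mem_neighborSet] at hy
      by_cases hp : (QuotientGroup.mk (affine e c) : BTVertex v) = f (QuotientGroup.mk (affine d a))
      · exact Or.inl hp
      · have hy' := hy
        rw [hadj, or_iff_right hp, hf, mk_affine_eq_iff, hpow] at hy'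
        obtain ⟨h1, h2⟩ := hy'
        obtain ⟨r, hr, hx⟩ := hres ((c - a) * (d : L)⁻¹) (by
          rw [map_mul, map_inv₀]
          exact mul_inv_le_one_of_le₀ h2 zero_le)
        refine Or.inr ⟨r, hr, ?_⟩
        rw [mk_affine_eq_iff, Units.val_mul, map_mul, hπ, h1, mul_assoc, ← exp_add]
        refine ⟨by simp, ?_⟩
        rw [exp_add, ← mul_assoc, ← h1]
        have h3 : c - (a + d * r) = d * ((c - a) * (d : L)⁻¹ - r) := by
          have := d.ne_zero
          field_simp
          ring
        rw [h3, map_mul]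
        exact mul_le_mul_right hx _
    refine (Set.encard_le_encard hsub).trans ((Set.encard_insert_le _ _).trans ?_)
    have := Set.encard_image_le
      (fun r : L => (QuotientGroup.mk (affine (d * π) (a + d * r)) : BTVertex v)) R
    rw [hR.encard_eq_coe_toFinset_card] at this
    push_cast
    gcongr

/-- Only scalar matrices act trivially on the Bruhat-Tits tree. -/
theorem mem_center_of_smul_eq (π : Lˣ) (hπ : v π = exp (-1)) (g : GL (Fin 2) L)
    (hg : ∀ x : BTVertex v, g • x = x) : g ∈ Subgroup.center (GL (Fin 2) L) := by
  have hdet : g 0 0 * g 1 1 - g 0 1 * g 1 0 ≠ 0 := by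
    rw [← Matrix.det_fin_two]
    exact g.det.ne_zero
  -- This is the fixed-point equation of the Möbius transformation: fixing all balls around `a`
  -- forces `a` to be fixed. The points `0`, `1` and `π` then suffice to make `g` scalar.
  have key : ∀ a : L, -(a ^ 2 * g 1 0) + a * (g 0 0 - g 1 1) + g 0 1 = 0 := by
    intro a
    by_contra hne
    set q := -(a ^ 2 * g 1 0) + a * (g 0 0 - g 1 1) + g 0 1 with hq
    have hb : ∀ d : Lˣ, v ((q * (d : L)⁻¹) ^ 2 * (g 0 0 * g 1 1 - g 0 1 * g 1 0)⁻¹) ≤ 1 := by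
      intro d
      have h := hg (QuotientGroup.mk (affine d a))
      rw [MulAction.Quotient.smul_mk, eq_comm, QuotientGroup.eq, mem_adjointIntegral_integer] at h
      have h01 := h 0 1 0 1
      rw [← Valuation.map_neg] at h01
      convert h01 using 2
      rw [mul_inv_rev, inv_inv, smul_eq_mul, mul_inv_rev]
      simp only [Units.val_mul, coe_affine, Matrix.coe_units_inv,
        Matrix.inv_def, Matrix.adjugate_fin_two, Matrix.det_fin_two, Ring.inverse_eq_inv']
      simp [Matrix.mul_apply, Fin.sum_univ_two]
      rw [hq]
      have := d.ne_zero
      field_simp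
      ring
    obtain ⟨m, hm⟩ := exists_valuation_eq_exp v hne
    obtain ⟨n, hn⟩ := exists_valuation_eq_exp v hdet
    -- The exponent makes the valuation `exp (2 * (m + |n| + |m| + 1) - n)`, which exceeds `1`.
    have := hb (π ^ (|n| + |m| + 1))
    rw [map_mul, map_pow, map_mul, map_inv₀, map_inv₀, Units.val_zpow_eq_zpow_val, map_zpow₀, hm,
      hn, hπ, ← exp_zsmul, ← exp_neg, ← exp_neg, ← exp_add, ← exp_nsmul, ← exp_add, ← exp_zero,
      exp_le_exp] at this
    simp only [smul_eq_mul, nsmul_eq_mul] at this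
    push_cast at this
    have h1 := neg_abs_le m
    have h2 := le_abs_self n
    have h3 := abs_nonneg m
    linarith [abs_nonneg n]
  have h0 : g 0 1 = 0 := by simpa using key 0
  have h1 : g 1 0 = g 0 0 - g 1 1 := by linear_combination -key 1 + h0
  have h2 : g 1 0 * (1 - (π : L)) = 0 := by
    have := key π
    rw [h0, ← h1] at this
    have h3 : (π : L) * (g 1 0 * (1 - (π : L))) = 0 := by linear_combination this
    exact (mul_eq_zero.1 h3).resolve_left π.ne_zero
  have h3 : (1 : L) - π ≠ 0 := by
    intro h
    rw [← sub_eq_zero.1 h, map_one, ← exp_zero, exp_inj] at hπ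
    omega
  have h10 : g 1 0 = 0 := (mul_eq_zero.1 h2).resolve_right h3
  exact mem_center_iff_entries.2 ⟨h0, h10, by linear_combination h10 - h1⟩

end Tree
end TreeProduct

/-! ### Places over `X = 0` and functions without poles -/

namespace TreeProduct
open WithZero Polynomial IsDedekindDomain

theorem valuation_le_one_of_isIntegral {A R Γ₀ : Type*} [CommRing A] [CommRing R] [Algebra A R]
    [LinearOrderedCommGroupWithZero Γ₀] (v : Valuation R Γ₀)
    (hA : ∀ a : A, v (algebraMap A R a) ≤ 1) {x : R} (hx : IsIntegral A x) : v x ≤ 1 := by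
  have h : IsIntegral v.integer x :=
    hx.map_of_comp_eq ((algebraMap A R).codRestrict v.integer hA) (RingHom.id R) rfl
  exact (Valuation.integer.integers v).mem_of_integral h

section Places

variable (k : Type*) [Field k] (L : Type*) [Field L] [Algebra k[X] L] [Algebra (RatFunc k) L]
  [IsScalarTower k[X] (RatFunc k) L] [FunctionField k L] [Algebra.IsSeparable (RatFunc k) L]

/-- The subring `k[X⁻¹]` of `k(X)`. -/
noncomputable abbrev polyInv : Subalgebra k (RatFunc k) :=
  Algebra.adjoin k {(RatFunc.X : RatFunc k)⁻¹}

/-- The set of places of `L` over the place `X = 0` of `k(X)`. -/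
def placesOverX : Set (HeightOneSpectrum (FunctionField.ringOfIntegers k L)) :=
  {w | algebraMap k[X] (FunctionField.ringOfIntegers k L) X ∈ w.asIdeal}

instance : Algebra.IsIntegral k[X] (FunctionField.ringOfIntegers k L) :=
  inferInstanceAs (Algebra.IsIntegral k[X] (integralClosure k[X] L))

omit [FunctionField k L] [Algebra.IsSeparable (RatFunc k) L] in
theorem algebraMap_ringOfIntegers_X_ne_zero :
    algebraMap k[X] (FunctionField.ringOfIntegers k L) X ≠ 0 := by
  exact fun h => X_ne_zero
    (FunctionField.ringOfIntegers.algebraMap_injective k L (h.trans (map_zero _).symm))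

theorem finite_placesOverX : (placesOverX k L).Finite := by
  have := Ideal.finite_factors (R := FunctionField.ringOfIntegers k L)
    (I := Ideal.span {algebraMap k[X] (FunctionField.ringOfIntegers k L) X})
    (Ideal.span_singleton_eq_bot.not.2 (algebraMap_ringOfIntegers_X_ne_zero k L))
  refine this.subset fun w hw => ?_
  exact Ideal.dvd_span_singleton.2 hw

-- Lying over. Faithfulness needs at least one tree.
omit [FunctionField k L] [Algebra.IsSeparable (RatFunc k) L] in
theorem nonempty_placesOverX : (placesOverX k L).Nonempty := by
  have : FaithfulSMul k[X] (FunctionField.ringOfIntegers k L) :=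
    (faithfulSMul_iff_algebraMap_injective _ _).2
      (FunctionField.ringOfIntegers.algebraMap_injective k L)
  have hmax : (Ideal.span {(X : k[X])}).IsMaximal :=
    PrincipalIdealRing.isMaximal_of_irreducible irreducible_X
  obtain ⟨P, hP, hover⟩ := Ideal.exists_maximal_ideal_liesOver_of_isIntegral
    (Ideal.span {(X : k[X])}) (S := FunctionField.ringOfIntegers k L)
  have hX : algebraMap k[X] (FunctionField.ringOfIntegers k L) X ∈ P := by
    have : (X : k[X]) ∈ P.under k[X] := by
      rw [← hover.over]
      exact Ideal.mem_span_singleton_self _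
    exact this
  exact ⟨⟨P, hP.isPrime, fun h => algebraMap_ringOfIntegers_X_ne_zero k L (by
    rwa [h, Ideal.mem_bot] at hX)⟩,
    hX⟩

theorem exists_uniformizer_unit (w : HeightOneSpectrum (FunctionField.ringOfIntegers k L)) :
    ∃ π : Lˣ, w.valuation L (π : L) = exp (-1) := by
  obtain ⟨π, hπ⟩ := w.valuation_exists_uniformizer L
  have : π ≠ 0 := by
    rintro rfl
    rw [map_zero] at hπ
    exact exp_ne_zero hπ.symm
  exact ⟨Units.mk0 π this, hπ⟩

theorem finite_quotient_placesOverX [Finite k] {w} (hw : w ∈ placesOverX k L) :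
    Finite (FunctionField.ringOfIntegers k L ⧸ w.asIdeal) := by
  have : Module.Finite k[X] (FunctionField.ringOfIntegers k L) :=
    Module.IsNoetherian.finite _ _
  let J : Ideal k[X] := w.asIdeal.under k[X]
  have hXJ : X ∈ J := hw
  -- Since `X ∈ J`, every class is represented by a constant.
  have : Finite (k[X] ⧸ J) := by
    refine Finite.of_surjective (fun a : k => Ideal.Quotient.mk J (C a)) fun q => ?_
    obtain ⟨f, rfl⟩ := Ideal.Quotient.mk_surjective q
    refine ⟨f.coeff 0, Ideal.Quotient.eq.2 ?_⟩
    have : C (f.coeff 0) - f = -(f.divX * X) := by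
      conv_lhs => rw [← divX_mul_X_add f]
      simp
    rw [this]
    exact J.neg_mem (J.mul_mem_left _ hXJ)
  have : Module.Finite (k[X] ⧸ J) (FunctionField.ringOfIntegers k L ⧸ w.asIdeal) :=
    Module.Finite.of_restrictScalars_finite k[X] _ _
  exact Module.finite_of_finite (k[X] ⧸ J)

theorem exists_finite_residues [Finite k] {w} (hw : w ∈ placesOverX k L) :
    ∃ R : Set L, R.Finite ∧ ∀ x, w.valuation L x ≤ 1 → ∃ r ∈ R, w.valuation L (x - r) ≤ exp (-1) := by
  have := finite_quotient_placesOverX k L hw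
  have hlt : ∀ x, w.valuation L x < 1 → w.valuation L x ≤ exp (-1) := by
    intro x hx
    rcases eq_or_ne x 0 with rfl | hx0
    · simp
    · obtain ⟨m, hm⟩ := exists_valuation_eq_exp (w.valuation L) hx0
      rw [hm, ← exp_zero, exp_lt_exp] at hx
      rw [hm, exp_le_exp]
      omega
  refine ⟨Set.range fun q : FunctionField.ringOfIntegers k L ⧸ w.asIdeal => algebraMap _ L q.out,
    Set.finite_range _, fun x hx => ?_⟩
  obtain ⟨a, ha⟩ := w.exists_valuation_sub_lt_of_integer hx 1
  refine ⟨_, ⟨Ideal.Quotient.mk _ a, rfl⟩, hlt _ ?_⟩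
  have h1 : x - algebraMap _ L (Quotient.out (Ideal.Quotient.mk w.asIdeal a)) =
      (x - algebraMap _ L a) + algebraMap _ L (a - Quotient.out (Ideal.Quotient.mk w.asIdeal a)) := by
    rw [map_sub]
    ring
  rw [h1]
  refine Valuation.map_add_lt _ ?_ ?_
  · rw [Valuation.map_sub_swap]
    simpa using ha
  · rw [HeightOneSpectrum.valuation_lt_one_iff_mem, ← Ideal.Quotient.eq]
    exact (Ideal.Quotient.mk_out _).symm

/-- Away from `X = 0` the function `X` is a unit, so `k[X⁻¹]`, and with it `y`, is integral there.
The places over `X = 0` are covered by `hw`. -/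
theorem isIntegral_of_valuation_le_one {y : L} (hy : IsIntegral (polyInv k) y)
    (hw : ∀ w ∈ placesOverX k L, w.valuation L y ≤ 1) : IsIntegral k[X] y := by
  obtain ⟨b, rfl⟩ := HeightOneSpectrum.mem_integers_of_valuation_le_one
    (R := FunctionField.ringOfIntegers k L) L y fun w => by
      by_cases hX : w ∈ placesOverX k L
      · exact hw w hX
      · refine valuation_le_one_of_isIntegral (w.valuation L) ?_ hy
        rintro ⟨a, ha⟩
        change w.valuation L (algebraMap (RatFunc k) L a) ≤ 1
        have hC : ∀ p : k[X], w.valuation L (algebraMap (RatFunc k) L (algebraMap k[X] _ p)) ≤ 1 := by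
          intro p
          rw [← IsScalarTower.algebraMap_apply,
            IsScalarTower.algebraMap_apply k[X] (FunctionField.ringOfIntegers k L) L]
          exact w.valuation_le_one _
        induction ha using Algebra.adjoin_induction with
        | mem x hx =>
          rw [Set.mem_singleton_iff.1 hx, map_inv₀, map_inv₀, ← RatFunc.algebraMap_X,
            ← IsScalarTower.algebraMap_apply,
            IsScalarTower.algebraMap_apply k[X] (FunctionField.ringOfIntegers k L) L,
            (w.valuation_eq_one_iff_notMem).2 hX, inv_one]
        | algebraMap r =>
          rw [IsScalarTower.algebraMap_apply k k[X] (RatFunc k)]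
          exact hC _
        | add x y _ _ h1 h2 =>
          rw [map_add]
          exact Valuation.map_add_le _ h1 h2
        | mul x y _ _ h1 h2 =>
          rw [map_mul, map_mul]
          exact mul_le_one' h1 h2
  exact b.2

open Classical in
theorem inftyValuation_polyInv_le_one (a : polyInv k) : RatFunc.inftyValuation k a ≤ 1 := by
  obtain ⟨a, ha⟩ := a
  change RatFunc.inftyValuation k a ≤ 1
  induction ha using Algebra.adjoin_induction with
  | mem x hx =>
    rw [Set.mem_singleton_iff.1 hx, map_inv₀, RatFunc.inftyValuation.X, ← exp_neg, ← exp_zero,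
      exp_le_exp]
    omega
  | algebraMap r =>
    rcases eq_or_ne r 0 with rfl | hr
    · simp
    · exact (RatFunc.inftyValuation.C k hr).le
  | add x y _ _ h1 h2 => exact Valuation.map_add_le _ h1 h2
  | mul x y _ _ h1 h2 =>
    rw [map_mul]
    exact mul_le_one' h1 h2

open Classical in
/-- A function that is integral away from the places over `X = 0` and at these places is a root of
a polynomial of bounded degree with constant coefficients. -/
theorem exists_constant_minpoly {y : L} (hy : IsIntegral (polyInv k) y)
    (hw : ∀ w ∈ placesOverX k L, w.valuation L y ≤ 1) :
    ∃ Q ∈ Polynomial.degreeLT k (Module.finrank (RatFunc k) L + 1), Q ≠ 0 ∧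
      Q.eval₂ (algebraMap (RatFunc k) L |>.comp (algebraMap k (RatFunc k))) y = 0 := by
  have hint := isIntegral_of_valuation_le_one k L hy hw
  have hmin := minpoly.isIntegrallyClosed_eq_field_fractions' (RatFunc k) hint
  have hFint : IsIntegral (RatFunc k) y := Algebra.IsIntegral.isIntegral y
  obtain ⟨f, hf, hfy⟩ := hy
  have hdvd : minpoly (RatFunc k) y ∣ f.map (algebraMap (polyInv k) (RatFunc k)) := by
    apply minpoly.dvd
    rw [aeval_def, eval₂_map]
    exact hfy
  have hlift := integralClosure.mem_lifts_of_monic_of_dvd_map (RatFunc k) hf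
    (minpoly.monic hFint) hdvd
  rw [lifts_iff_coeff_lifts] at hlift
  -- A coefficient is a polynomial in `X` and also integral over `k[X⁻¹]`, so it is bounded at
  -- infinity and has degree `0`.
  have hcoeff : ∀ i, ∃ a : k, (minpoly k[X] y).coeff i = C a := by
    intro i
    obtain ⟨c, hc⟩ := hlift i
    have hle := valuation_le_one_of_isIntegral (RatFunc.inftyValuation k)
      (inftyValuation_polyInv_le_one k) c.2
    change (c : RatFunc k) = _ at hc
    rw [hc, hmin, coeff_map] at hle
    rcases eq_or_ne ((minpoly k[X] y).coeff i) 0 with h0 | h0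
    · exact ⟨0, by rw [h0, C_0]⟩
    · rw [RatFunc.inftyValuation_apply, RatFunc.inftyValuation.polynomial k h0, ← exp_zero,
        exp_le_exp] at hle
      exact ⟨_, eq_C_of_natDegree_eq_zero (by omega)⟩
  have hmem : minpoly k[X] y ∈ lifts (C : k →+* k[X]) := by
    rw [lifts_iff_coeff_lifts]
    intro i
    obtain ⟨a, ha⟩ := hcoeff i
    exact ⟨a, ha.symm⟩
  obtain ⟨Q, hQ, hdeg⟩ := (exists_degree_eq_of_mem_lifts hmem)
  have hmap : minpoly (RatFunc k) y = Q.map (algebraMap k (RatFunc k)) := by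
    rw [hmin, ← hQ, map_map]
    rfl
  refine ⟨Q, ?_, ?_, ?_⟩
  · rw [mem_degreeLT, ← degree_map Q (algebraMap k (RatFunc k)), ← hmap,
      degree_eq_natDegree (minpoly.ne_zero hFint)]
    exact_mod_cast Nat.lt_succ_of_le (minpoly.natDegree_le y)
  · rintro rfl
    exact minpoly.ne_zero hFint (by simpa using hmap)
  · rw [← eval₂_map, ← hmap]
    exact minpoly.aeval _ y

/-- Over a finite field there are finitely many polynomials of bounded degree, each nonzero one with
finitely many roots. -/
theorem finite_setOf_integral_everywhere [Finite k] :
    {y : L | IsIntegral (polyInv k) y ∧ ∀ w ∈ placesOverX k L, w.valuation L y ≤ 1}.Finite := by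
  classical
  set j : k →+* L := (algebraMap (RatFunc k) L).comp (algebraMap k (RatFunc k))
  set n := Module.finrank (RatFunc k) L + 1
  have hfin : Finite (degreeLT k n) := Finite.of_equiv _ (degreeLTEquiv k n).symm.toEquiv
  have hfin' : ((degreeLT k n : Set k[X])).Finite := hfin
  refine (hfin'.biUnion fun Q _ => (Q.map j).roots.toFinset.finite_toSet).subset ?_
  rintro y ⟨hy, hw⟩
  obtain ⟨Q, hQ, hQ0, hQy⟩ := exists_constant_minpoly k L hy hw
  refine Set.mem_biUnion hQ ?_
  rw [Finset.mem_coe, Multiset.mem_toFinset, mem_roots (by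
    rwa [Ne, Polynomial.map_eq_zero_iff j.injective]), IsRoot.def, eval_map]
  exact hQy

end Places
end TreeProduct

/-! ### Change of variable -/

namespace TreeProduct
open Polynomial

section ChangeOfVariable

variable {k : Type*} [Field k]

/-- An endomorphism of finite degree of the field `k(X)` which sends `X⁻¹` to `X + 1 / f`. -/
theorem exists_finite_endomorphism {f : k[X]} (hf : f ≠ 0) :
    ∃ j : RatFunc k →ₐ[k] RatFunc k, j.toRingHom.Finite ∧
      j RatFunc.X⁻¹ = RatFunc.X + (algebraMap k[X] (RatFunc k) f)⁻¹ := by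
  set s : RatFunc k := RatFunc.X + (algebraMap k[X] (RatFunc k) f)⁻¹ with hs
  have hf' : algebraMap k[X] (RatFunc k) f ≠ 0 := RatFunc.algebraMap_ne_zero hf
  have hsC : ∀ c, s ≠ RatFunc.C c := by
    intro c hc
    have h1 : algebraMap k[X] (RatFunc k) ((C c - X) * f) = algebraMap k[X] (RatFunc k) 1 := by
      rw [map_mul, map_sub, RatFunc.algebraMap_C, ← hc, RatFunc.algebraMap_X, hs, add_sub_cancel_left,
        inv_mul_cancel₀ hf', map_one]
    have h2 := IsUnit.of_mul_eq_one _ (RatFunc.algebraMap_injective k h1)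
    have h3 := natDegree_eq_zero_of_isUnit h2
    rw [← neg_sub, natDegree_neg, natDegree_X_sub_C] at h3
    exact one_ne_zero h3
  have hs' : ¬ ∃ c, s⁻¹ = RatFunc.C c := by
    rintro ⟨c, hc⟩
    exact hsC c⁻¹ (by rw [map_inv₀, ← hc, inv_inv])
  -- As `s` is not constant, `X ↦ s⁻¹` embeds `k(X)` onto `k(s⁻¹)`, over which `k(X)` is finite.
  have htr : Transcendental k s⁻¹ := s⁻¹.transcendental_of_ne_C hs'
  have hfin : FiniteDimensional (IntermediateField.adjoin k {s⁻¹}) (RatFunc k) :=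
    FunctionField.finiteDimensional_of_adjoin_transcendental htr
  let e := RatFunc.algEquivOfTranscendental s⁻¹ htr
  refine ⟨(IntermediateField.val _).comp e.toAlgHom, ?_, ?_⟩
  · have h1 : (algebraMap (IntermediateField.adjoin k {s⁻¹}) (RatFunc k)).Finite :=
      RingHom.finite_algebraMap.2 hfin
    exact h1.comp (RingHom.Finite.of_surjective e.toRingEquiv.toRingHom e.surjective)
  · rw [map_inv₀]
    change ((e RatFunc.X : IntermediateField.adjoin k {s⁻¹}) : RatFunc k)⁻¹ = s
    rw [RatFunc.algEquivOfTranscendental_X, inv_inv]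

/-- Given finitely many elements of a function field, one can choose the variable in such a way
that these elements have poles at most over `X = 0`. -/
theorem exists_change_of_variable {K : Type*} [Field K] (i : RatFunc k →+* K) (hi : i.Finite)
    (E : Finset K) : ∃ j : RatFunc k →+* K, j.Finite ∧
      ∀ e ∈ E, (j.comp (algebraMap (polyInv k) (RatFunc k))).IsIntegralElem e := by
  -- With a common denominator `f`, the elements of `E` have poles only at infinity and at zeros of
  -- `f`, which are exactly the poles of `X + 1 / f`.
  obtain ⟨f, hf, hfE⟩ : ∃ f : k[X], f ≠ 0 ∧ ∀ e ∈ E,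
      (i.comp (algebraMap k[X] (RatFunc k))).IsIntegralElem (i (algebraMap _ _ f) * e) := by
    let := i.toAlgebra
    let := (i.comp (algebraMap k[X] (RatFunc k))).toAlgebra
    have : IsScalarTower k[X] (RatFunc k) K := .of_algebraMap_eq fun _ => rfl
    have : FiniteDimensional (RatFunc k) K := hi
    obtain ⟨f, hf, h⟩ := exists_integral_multiples k[X] (RatFunc k) E
    exact ⟨f, hf, fun e he => by
      have := h e he
      rw [Algebra.smul_def] at this
      exact this⟩
  wlog hmonic : f.Monic generalizing f
  · have hl : f.leadingCoeff⁻¹ ≠ 0 := inv_ne_zero (leadingCoeff_ne_zero.2 hf)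
    refine this (f * C f.leadingCoeff⁻¹) (mul_ne_zero hf (C_ne_zero.2 hl)) (fun e he => ?_)
      (monic_mul_leadingCoeff_inv hf)
    have h1 := (i.comp (algebraMap k[X] (RatFunc k))).isIntegralElem_map (x := C f.leadingCoeff⁻¹)
    have h2 := RingHom.IsIntegralElem.mul _ h1 (hfE e he)
    rw [mul_comm f, map_mul, map_mul, mul_assoc]
    exact h2
  obtain ⟨j, hj, hjX⟩ := exists_finite_endomorphism hf
  refine ⟨i.comp j.toRingHom, hi.comp hj, ?_⟩
  set h : polyInv k →+* K := (i.comp j.toRingHom).comp (algebraMap (polyInv k) (RatFunc k)) with hh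
  let := h.toAlgebra
  let Y : polyInv k := ⟨RatFunc.X⁻¹, Algebra.subset_adjoin rfl⟩
  have hhC : ∀ a, h (algebraMap k (polyInv k) a) = i (algebraMap k (RatFunc k) a) := by
    intro a
    change i (j (algebraMap k (RatFunc k) a)) = _
    rw [j.commutes]
  have hhY : h Y = i RatFunc.X + (i (algebraMap k[X] (RatFunc k) f))⁻¹ := by
    change i (j RatFunc.X⁻¹) = _
    rw [hjX, map_add, map_inv₀]
  have hf' : i (algebraMap k[X] (RatFunc k) f) ≠ 0 :=
    (map_ne_zero i).2 (RatFunc.algebraMap_ne_zero hf)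
  have heval : ∀ q : k[X], (q.map (algebraMap k (polyInv k))).eval₂ h (i RatFunc.X) =
      i (algebraMap k[X] (RatFunc k) q) := by
    intro q
    rw [eval₂_map]
    have : h.comp (algebraMap k (polyInv k)) = i.comp (algebraMap k (RatFunc k)) :=
      RingHom.ext hhC
    rw [this, ← hom_eval₂, ← RatFunc.algebraMap_X, ← aeval_def, aeval_algebraMap_apply,
      aeval_X_left_apply]
  have hX : IsIntegral (polyInv k) (i RatFunc.X) := by
    -- From `Y = X + 1 / f(X)` follows `(X - Y) f(X) + 1 = 0`, which is monic in `X` because `f` is.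
    refine ⟨(X - C Y) * f.map (algebraMap k (polyInv k)) + 1, ?_, ?_⟩
    · have hm : (f.map (algebraMap k (polyInv k))).Monic := hmonic.map _
      refine ((monic_X_sub_C Y).mul hm).add_of_left ?_
      rw [hm.degree_mul, degree_X_sub_C, degree_one]
      have : 0 ≤ (f.map (algebraMap k (polyInv k))).degree := zero_le_degree_iff.2 hm.ne_zero
      exact lt_of_lt_of_le zero_lt_one (le_add_of_nonneg_right this)
    · change eval₂ h _ _ = 0
      rw [eval₂_add, eval₂_mul, heval, eval₂_sub, eval₂_X, eval₂_C, hhY, eval₂_one]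
      field_simp
      ring
  have hpoly : ∀ q : k[X], IsIntegral (polyInv k) (i (algebraMap k[X] (RatFunc k) q)) := by
    intro q
    induction q using Polynomial.induction_on' with
    | add p q hp hq =>
      rw [map_add, map_add]
      exact hp.add hq
    | monomial n a =>
      rw [← C_mul_X_pow_eq_monomial, map_mul, map_mul, map_pow, map_pow, RatFunc.algebraMap_X]
      refine IsIntegral.mul ?_ (hX.pow n)
      have : i (algebraMap k[X] (RatFunc k) (C a)) =
          algebraMap (polyInv k) K (algebraMap k (polyInv k) a) := (hhC a).symm
      rw [this]
      exact isIntegral_algebraMap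
  have hinv : IsIntegral (polyInv k) (i (algebraMap k[X] (RatFunc k) f))⁻¹ := by
    have : (i (algebraMap k[X] (RatFunc k) f))⁻¹ = algebraMap (polyInv k) K Y - i RatFunc.X :=
      eq_sub_of_add_eq' hhY.symm
    rw [this]
    exact isIntegral_algebraMap.sub hX
  intro e he
  change IsIntegral (polyInv k) e
  have h1 : IsIntegral (integralClosure (polyInv k) K) (i (algebraMap k[X] (RatFunc k) f) * e) := by
    let := (i.comp (algebraMap k[X] (RatFunc k))).toAlgebra
    exact IsIntegral.map_of_comp_eq (R := k[X]) (S := K)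
      ((i.comp (algebraMap k[X] (RatFunc k))).codRestrict (integralClosure (polyInv k) K) hpoly)
      (RingHom.id K) rfl (hfE e he)
  have h2 := (isIntegral_trans (R := polyInv k) _ h1).mul hinv
  rwa [mul_comm, inv_mul_cancel_left₀ hf'] at h2

end ChangeOfVariable

/-! ### Reduction to separable extensions -/

section Separable

/-- A function field of positive characteristic embeds in a separable one, by a power of Frobenius;
the embedding preserves integrality over `k[X⁻¹]`. -/
theorem exists_separable_embedding {k : Type} [Field k] (p : ℕ) [Fact p.Prime] [CharP k p]
    {K : Type*} [Field K] (j : RatFunc k →+* K) (hj : j.Finite) :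
    ∃ (L : Type) (_ : Field L) (_ : Algebra (RatFunc k) L),
      FunctionField k L ∧ Algebra.IsSeparable (RatFunc k) L ∧
      ∃ ι : K →+* L, ∀ e,
        (j.comp (algebraMap (polyInv k) (RatFunc k))).IsIntegralElem e →
          IsIntegral (polyInv k) (ι e) := by
  let := j.toAlgebra
  have : FiniteDimensional (RatFunc k) K := hj
  -- Working inside the algebraic closure also moves `K` from an arbitrary universe to `Type`.
  let φ : K →ₐ[RatFunc k] AlgebraicClosure (RatFunc k) := IsAlgClosed.lift
  have : FiniteDimensional (RatFunc k) φ.fieldRange :=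
    φ.toLinearMap.finiteDimensional_range
  have : CharP (RatFunc k) p := charP_of_injective_algebraMap (algebraMap k (RatFunc k)).injective p
  let S := separableClosure (RatFunc k) φ.fieldRange
  have : CharP S p := charP_of_injective_algebraMap (algebraMap (RatFunc k) S).injective p
  -- The field is purely inseparable over `S`, so a power of Frobenius lands in `S`. This map need
  -- not be `k(X)`-linear; it preserves integrality because it raises elements to a power.
  let F : φ.fieldRange →+* S := IsPurelyInseparable.iterateFrobenius S φ.fieldRange p le_rfl
  let r : K →+* φ.fieldRange := φ.toRingHom.codRestrict φ.fieldRange fun x => ⟨x, rfl⟩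
  refine ⟨S, inferInstance, inferInstance, inferInstance, inferInstance, F.comp r, fun e he => ?_⟩
  have he' : IsIntegral (polyInv k) e := he
  have h1 : IsIntegral (polyInv k) (φ e) := he'.map (φ.restrictScalars (polyInv k))
  have h2 := h1.pow (p ^ IsPurelyInseparable.exponent S φ.fieldRange)
  have h3 : algebraMap S φ.fieldRange (F (r e)) = _ :=
    IsPurelyInseparable.algebraMap_iterateFrobenius S p le_rfl (r e)
  have h4 : ((algebraMap S φ.fieldRange (F (r e)) : φ.fieldRange) :
      AlgebraicClosure (RatFunc k)) = φ e ^ p ^ IsPurelyInseparable.exponent S φ.fieldRange := by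
    rw [h3]
    rfl
  rw [← h4] at h2
  let ψ : S →ₐ[polyInv k] AlgebraicClosure (RatFunc k) :=
    ((φ.fieldRange.val.comp S.val).restrictScalars (polyInv k))
  exact (isIntegral_algHom_iff ψ ψ.toRingHom.injective).1 h2

end Separable
end TreeProduct

/-! ### The action on the trees and the main theorem -/

namespace TreeProduct
open Polynomial IsDedekindDomain

/-- A group homomorphism on `GL₂` which is trivial on scalars takes finitely many values on the
matrices for which the products of their entries and of the entries of their inverses lie in a
given finite set. -/
theorem finite_image_of_finite_entries {L G : Type*} [Field L] [Group G] (ρ : GL (Fin 2) L →* G)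
    (hρ : ∀ g ∈ Subgroup.center (GL (Fin 2) L), ρ g = 1) {C : Set L} (hC : C.Finite) :
    (ρ '' {g | ∀ i j k l, g i j * g⁻¹ k l ∈ C}).Finite := by
  set G₀ := {g : GL (Fin 2) L | ∀ i j k l, g i j * g⁻¹ k l ∈ C}
  let E : GL (Fin 2) L → Fin 2 → Fin 2 → Fin 2 → Fin 2 → L := fun g i j k l => g i j * g⁻¹ k l
  have hE : (E '' G₀).Finite := by
    refine (Set.Finite.pi' fun i => Set.Finite.pi' fun j => Set.Finite.pi' fun k =>
      Set.Finite.pi' fun l => hC).subset ?_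
    rintro _ ⟨g, hg, rfl⟩
    exact hg
  -- One matrix is chosen for each table of products; any other with the same table differs from it
  -- by a scalar, which `ρ` kills.
  refine (hE.image fun t => ρ (Function.invFunOn E G₀ t)).subset ?_
  rintro _ ⟨g, hg, rfl⟩
  refine ⟨E g, ⟨g, hg, rfl⟩, ?_⟩
  have h : E (Function.invFunOn E G₀ (E g)) = E g := Function.invFunOn_eq ⟨g, hg, rfl⟩
  have hc := hρ _ (inv_mul_mem_center fun i j k l =>
    congrFun (congrFun (congrFun (congrFun h i) j) k) l)
  rwa [map_mul, map_inv, inv_mul_eq_one] at hc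

/-- `PGL₂` of a separable function field `L` over a finite field acts faithfully on a finite product
of trees of bounded valence, such that a vertex stabilizer has finite intersection with the
arithmetic subgroup given by the integral closure of `k[X⁻¹]`. -/
theorem exists_action_on_trees (k : Type) [Field k] [Finite k] (L : Type) [Field L]
    [Algebra (RatFunc k) L] [FunctionField k L] [Algebra.IsSeparable (RatFunc k) L] :
    ∃ (n : ℕ) (V : Fin n → Type) (T : ∀ i, SimpleGraph (V i)),
      (∀ i, IsBoundedValenceTree (T i)) ∧ ∃ ρ : GL (Fin 2) L →* Aut T,
        (∀ g, ρ g = 1 ↔ g ∈ Subgroup.center (GL (Fin 2) L)) ∧ ∃ x,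
          (ρ '' {g | g ∈ adjointIntegral (integralClosure (polyInv k) L).toSubring ∧
            (ρ g : Equiv.Perm (∀ i, V i)) x = x}).Finite := by
  let : Algebra k[X] L :=
    ((algebraMap (RatFunc k) L).comp (algebraMap k[X] (RatFunc k))).toAlgebra
  have : IsScalarTower k[X] (RatFunc k) L := .of_algebraMap_eq fun _ => rfl
  have := (finite_placesOverX k L).to_subtype
  let e := (Finite.equivFin (placesOverX k L)).symm
  let T := fun i => btGraph ((e i).1.valuation L)
  let ρ : GL (Fin 2) L →* Aut T := diagonalAut T fun i => btGraph_adj_smul _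
  have hρ : ∀ g, ρ g = 1 ↔ g ∈ Subgroup.center (GL (Fin 2) L) := by
    refine fun g => ⟨fun h => ?_, fun h => ?_⟩
    · obtain ⟨w, hw⟩ := nonempty_placesOverX k L
      obtain ⟨i, hi⟩ := e.surjective ⟨w, hw⟩
      obtain ⟨π, hπ⟩ := exists_uniformizer_unit k L (e i).1
      refine mem_center_of_smul_eq _ π hπ g fun x => ?_
      let y : ∀ i, BTVertex ((e i).1.valuation L) :=
        Function.update (fun _ => QuotientGroup.mk 1) i x
      have hy : y i = x := Function.update_self ..
      have h1 : g • y i = y i := congrArg (fun a : Aut T => (a : Equiv.Perm _) y i) h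
      rwa [hy] at h1
    · refine Subtype.ext (Equiv.ext fun x => funext fun i => ?_)
      exact center_smul_btVertex _ h (x i)
  refine ⟨_, _, T, fun i => ?_, ρ, hρ, fun _ => QuotientGroup.mk 1, ?_⟩
  · obtain ⟨π, hπ⟩ := exists_uniformizer_unit k L (e i).1
    obtain ⟨R, hR, hres⟩ := exists_finite_residues k L (e i).2
    exact isBoundedValenceTree_btGraph _ π hπ R hR hres
  · refine (finite_image_of_finite_entries ρ (fun g hg => (hρ g).2 hg)
      (finite_setOf_integral_everywhere k L)).subset (Set.image_mono ?_)
    -- Fixing the base vertex means that the coefficients are integral at every place over `X = 0`;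
    -- `hg` controls the others.
    rintro g ⟨hg, hx⟩ i j m l
    refine ⟨hg i j m l, fun w hw => ?_⟩
    obtain ⟨a, ha⟩ := e.surjective ⟨w, hw⟩
    have h1 : (QuotientGroup.mk (g * 1) : BTVertex ((e a).1.valuation L)) = QuotientGroup.mk 1 :=
      congrFun hx a
    rw [mul_one, eq_comm, QuotientGroup.eq, inv_one, one_mul, mem_adjointIntegral_integer] at h1
    have h2 := h1 i j m l
    rwa [ha] at h2

theorem map_mem_center_iff {K L : Type*} [Field K] [Field L] (ι : K →+* L) (g : GL (Fin 2) K) :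
    Matrix.GeneralLinearGroup.map ι g ∈ Subgroup.center (GL (Fin 2) L) ↔
      g ∈ Subgroup.center (GL (Fin 2) K) := by
  simp [mem_center_iff_entries, ι.injective.eq_iff]

end TreeProduct

open TreeProduct in
/-- A finitely generated group with a faithful representation into `PGL₂` of a global field of
characteristic `p > 0` (a finite extension of `𝔽_p(t)`) has a discrete and faithful representation
into the automorphism group of a finite product of finite-valence (indeed bounded-valence) trees. -/
theorem mainTheorem3 (p : ℕ) [Fact p.Prime] {K : Type*} [Field K]
    [Algebra (RatFunc (ZMod p)) K] [FunctionField (ZMod p) K]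
    {Γ : Type*} [Group Γ] [Group.FG Γ]
    (φ : Γ →* PGL(2, K)) (hφ : Function.Injective φ) :
    ∃ (n : ℕ) (V : Fin n → Type) (T : ∀ i, SimpleGraph (V i)),
      (∀ i, TreeProduct.IsBoundedValenceTree (T i)) ∧
      ∃ ρ : Γ →* TreeProduct.Aut T,
        Function.Injective ρ ∧ DiscreteTopology ρ.range := by
  classical
  obtain ⟨gens, hgens⟩ := Group.fg_def.1 (inferInstance : Group.FG Γ)
  choose lift hlift using Matrix.ProjGenLinGroup.mk_surjective (n := Fin 2) (R := K)
  let E : Finset K := gens.biUnion fun s => Finset.univ.image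
    fun q : (Fin 2 × Fin 2) × Fin 2 × Fin 2 =>
      lift (φ s) q.1.1 q.1.2 * (lift (φ s))⁻¹ q.2.1 q.2.2
  obtain ⟨j, hj, hE⟩ := exists_change_of_variable (algebraMap (RatFunc (ZMod p)) K)
    (RingHom.finite_algebraMap.2 ‹_›) E
  obtain ⟨L, _, _, _, _, ι, hι⟩ := exists_separable_embedding p j hj
  obtain ⟨n, V, T, hT, ρ, hker, x, hfin⟩ := exists_action_on_trees (ZMod p) L
  let A : Subring L := (integralClosure (polyInv (ZMod p)) L).toSubring
  have hΓ : ∀ γ : Γ, ∃ g : GL (Fin 2) K, Matrix.ProjGenLinGroup.mk g = φ γ ∧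
      Matrix.GeneralLinearGroup.map ι g ∈ adjointIntegral A := by
    -- Scalars do not affect the coefficients, but a lift is not canonical; the elements having an
    -- integral lift form a subgroup, so checking generators is enough.
    let H : Subgroup Γ := (((adjointIntegral A).comap (Matrix.GeneralLinearGroup.map ι)).map
      Matrix.ProjGenLinGroup.mk).comap φ
    have hH : H = ⊤ := by
      rw [eq_top_iff, ← hgens, Subgroup.closure_le]
      intro s hs
      refine ⟨lift (φ s), fun a b c d => ?_, hlift _⟩
      rw [← map_inv]
      change ι _ * ι _ ∈ A
      rw [← map_mul]
      exact hι _ (hE _ (Finset.mem_biUnion.2 ⟨s, hs, Finset.mem_image.2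
        ⟨((a, b), c, d), Finset.mem_univ _, rfl⟩⟩))
    intro γ
    obtain ⟨g, hg, hgφ⟩ : γ ∈ H := hH ▸ Subgroup.mem_top γ
    exact ⟨g, hgφ, hg⟩
  let ρK : PGL(2, K) →* Aut T := QuotientGroup.lift (Subgroup.center (GL (Fin 2) K))
    (ρ.comp (Matrix.GeneralLinearGroup.map ι)) fun g hg =>
      (hker _).2 ((map_mem_center_iff ι g).2 hg)
  have hρK : ∀ g, ρK (Matrix.ProjGenLinGroup.mk g) = ρ (Matrix.GeneralLinearGroup.map ι g) :=
    fun g => rfl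
  have hinj : Function.Injective ρK := by
    rw [injective_iff_map_eq_one]
    intro q hq
    obtain ⟨g, rfl⟩ := Matrix.ProjGenLinGroup.mk_surjective q
    rw [hρK, hker, map_mem_center_iff] at hq
    exact Matrix.ProjGenLinGroup.mk_eq_one.2 hq
  refine ⟨n, V, T, hT, ρK.comp φ, hinj.comp hφ, discreteTopology_of_finite_stabilizer _ x ?_⟩
  refine Set.Finite.of_finite_image (hfin.subset ?_) Subtype.val_injective.injOn
  rintro _ ⟨⟨_, γ, rfl⟩, hγ, rfl⟩
  obtain ⟨g, hg, hgA⟩ := hΓ γ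
  have h1 : ρK.comp φ γ = ρ (Matrix.GeneralLinearGroup.map ι g) := by
    rw [MonoidHom.comp_apply, ← hg, hρK]
  refine ⟨_, ⟨hgA, ?_⟩, h1.symm⟩
  rw [← h1]
  exact hγ
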